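/- Let $N\ge 0$ be an integer. Let $(p_0,\dots,p_{N^*})$ be either of the two lists $N^*=N$, $p_i=2i$, or $N^*=2N$, $p_i=i$. For real numbers $0<\rho_1<\rho_2$ and $h_1,h_2,g>0$ put $$c_{\rm SW}^2=\frac{(\rho_2-\rho_1)g h_1h_2}{\rho_1h_2+\rho_2h_1},$$ and, for $\xi\in\mathbf R^n\setminus\{0\}$, $$c_{\rm IW}(\xi)^2=\frac{(\rho_2-\rho_1)g}{\rho_1|\xi|\coth(h_1|\xi|)+\rho_2|\xi|\coth(h_2|\xi|)},$$ $$c_{\rm K}(\xi)^2=\frac{(\rho_2-\rho_1)g\,|\xi|^{-2}\det\mathcal A_1(h_1\xi)\det\mathcal A_2(h_2\xi)}{\rho_1h_1\det\tilde{\mathcal A}_1(h_1\xi)\det\mathcal A_2(h_2\xi)+\rho_2h_2\det\tilde{\mathcal A}_2(h_2\xi)\det\mathcal A_1(h_1\xi)}.$$ These are the squared phase speeds of plane waves with wave vector $\xi$ for the linearizations around the rest state (flat bottom) of the full model for interfacial gravity waves and of the Kakinuma model, respectively. Here $$\mathcal A_1(\xi)=\Bigl(\tfrac{|\xi|^2}{2(i+j)+1}+\tfrac{4ij}{2(i+j)-1}\Bigr)_{0\le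 i,j\le N},\qquad \mathcal A_2(\xi)=\Bigl(\tfrac{|\xi|^2}{p_i+p_j+1}+\tfrac{p_ip_j}{p_i+p_j-1}\Bigr)_{0\le i,j\le N^*},$$ with the convention $\frac00=0$, and $\tilde{\mathcal A}=\begin{pmatrix}0&\mathbf 1^{\rm T}\\-\mathbf 1&\mathcal A\end{pmatrix}$ with $\mathbf 1=(1,\dots,1)^{\rm T}$. Then the denominator of $c_{\rm K}(\xi)^2$ is positive for $\xi\neq0$, both $c_{\rm IW}^2$ and $c_{\rm K}^2$ extend continuously to $\xi=0$ with the value $c_{\rm SW}^2$, and with these extensions, for all $n$, all $\xi\in\mathbf R^n$, all $\rho_2>\rho_1>0$ and all $h_1,h_2,g>0$, $$\left|\Bigl(\frac{c_{\rm IW}(\xi)}{c_{\rm SW}}\Bigr)^2-\Bigl(\frac{c_{\rm K}(\xi)}{c_{\rm SW}}\Bigr)^2\right|\le C\,(h_1|\xi|+h_2|\xi|)^{4N+2},$$ where $C>0$ depends only on $N$. -/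

import Mathlib

noncomputable section

namespace Kakinuma

/-- The hyperbolic cotangent. -/
def coth (x : ℝ) : ℝ := Real.cosh x / Real.sinh x

/-- The square of the phase speed of infinitely long and small interfacial waves,
`c_SW² = (ρ₂ - ρ₁) g h₁ h₂ / (ρ₁ h₂ + ρ₂ h₁)`. -/
def cSWsq (ρ₁ ρ₂ h₁ h₂ g : ℝ) : ℝ :=
  (ρ₂ - ρ₁) * g * h₁ * h₂ / (ρ₁ * h₂ + ρ₂ * h₁)

open scoped Classical in
/-- The squared phase speed `c_IW(ξ)²` of the plane waves with wave vector `ξ` for the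
linearization around the rest state of the full model for interfacial gravity waves. The formula has
a removable singularity at `ξ = 0`, where the value is the limit `c_SW²`. -/
def cIWsq (ρ₁ ρ₂ h₁ h₂ g : ℝ) {n : ℕ} (ξ : EuclideanSpace ℝ (Fin n)) : ℝ :=
  if ξ = 0 then cSWsq ρ₁ ρ₂ h₁ h₂ g
  else (ρ₂ - ρ₁) * g / (ρ₁ * ‖ξ‖ * coth (h₁ * ‖ξ‖) + ρ₂ * ‖ξ‖ * coth (h₂ * ‖ξ‖))

/-- The matrix `(1 / (p_i + p_j + 1))_{0 ≤ i, j ≤ M}`. -/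
def matA0 {M : ℕ} (p : Fin (M + 1) → ℕ) : Matrix (Fin (M + 1)) (Fin (M + 1)) ℝ :=
  Matrix.of fun i j => 1 / ((p i : ℝ) + (p j : ℝ) + 1)

/-- The matrix `(p_i p_j / (p_i + p_j - 1))_{0 ≤ i, j ≤ M}`, with the convention `0 / 0 = 0`. -/
def matA1 {M : ℕ} (p : Fin (M + 1) → ℕ) : Matrix (Fin (M + 1)) (Fin (M + 1)) ℝ :=
  Matrix.of fun i j => ((p i : ℝ) * (p j : ℝ)) / ((p i : ℝ) + (p j : ℝ) - 1)

/-- The matrix `𝒜(ξ) = |ξ|² A₀ + A₁` attached to the exponents `p_0, …, p_M`. -/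
def symbA {M : ℕ} (p : Fin (M + 1) → ℕ) {n : ℕ} (ξ : EuclideanSpace ℝ (Fin n)) :
    Matrix (Fin (M + 1)) (Fin (M + 1)) ℝ :=
  ‖ξ‖ ^ 2 • matA0 p + matA1 p

/-- The bordered matrix `[0, 1ᵀ; -1, A]`, where `1` is the vector whose entries all equal one. -/
def bordered {M : ℕ} (A : Matrix (Fin (M + 1)) (Fin (M + 1)) ℝ) :
    Matrix (Unit ⊕ Fin (M + 1)) (Unit ⊕ Fin (M + 1)) ℝ :=
  Matrix.fromBlocks 0 (Matrix.of fun _ _ => 1) (Matrix.of fun _ _ => -1) A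

/-- The exponents `0, 2, …, 2N` used in the upper layer. -/
def evenExp (N : ℕ) : Fin (N + 1) → ℕ := fun i => 2 * (i : ℕ)

/-- The coefficient of `ω²` in the dispersion relation of the Kakinuma model linearized around
the rest state over a flat bottom, with exponents `0, 2, …, 2N` in the upper layer and
`p_0, …, p_M` in the lower layer. -/
def dispCoeff (N : ℕ) {M : ℕ} (p : Fin (M + 1) → ℕ) (ρ₁ ρ₂ h₁ h₂ : ℝ) {n : ℕ}
    (ξ : EuclideanSpace ℝ (Fin n)) : ℝ :=
  ρ₁ * h₁ * (bordered (symbA (evenExp N) (h₁ • ξ))).det * (symbA p (h₂ • ξ)).det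
    + ρ₂ * h₂ * (bordered (symbA p (h₂ • ξ))).det * (symbA (evenExp N) (h₁ • ξ)).det

open scoped Classical in
/-- The squared phase speed `c_K(ξ)²` of the plane waves with wave vector `ξ` for the Kakinuma
model linearized around the rest state over a flat bottom. The formula has a removable
singularity at `ξ = 0`, where the value is the limit `c_SW²`. -/
def cKsq (N : ℕ) {M : ℕ} (p : Fin (M + 1) → ℕ) (ρ₁ ρ₂ h₁ h₂ g : ℝ) {n : ℕ}
    (ξ : EuclideanSpace ℝ (Fin n)) : ℝ :=
  if ξ = 0 then cSWsq ρ₁ ρ₂ h₁ h₂ g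
  else (ρ₂ - ρ₁) * g * (‖ξ‖ ^ 2)⁻¹
      * (symbA (evenExp N) (h₁ • ξ)).det * (symbA p (h₂ • ξ)).det
    / dispCoeff N p ρ₁ ρ₂ h₁ h₂ ξ

end Kakinuma

end

/-!
Write `s = hᵢ |ξ|` in either layer. By the Schur complement formula `det 𝒜̃ = det 𝒜 · 1ᵀ 𝒜⁻¹ 1`, so
both speeds have the form `(ρ₂ - ρ₁) g / (ρ₁ / h₁ · y₁ + ρ₂ / h₂ · y₂)`, where `yᵢ = s coth s` for
`c_IW²` and `yᵢ = q(s) = s² 1ᵀ 𝒜(s)⁻¹ 1` (`layerFun`) for `c_K²`; `yᵢ = 1` gives `c_SW²`. Everything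
reduces to the two one-layer facts `1 ≤ q(s) ≤ s coth s ≤ 1 + s` and
`s coth s - q(s) ≤ C s ^ (4 N + 2)`.

These are variational. The quadratic form of `𝒜(s)` is the energy `E(φ) = ∫₀¹ (φ'² + s² φ²)` of the
profile `φ(z) = ∑ cᵢ z ^ pᵢ` (`dotProduct_layerMat_mulVec`), so `s² / q(s)` is the minimum of `E`
over the profiles with `φ(1) = 1`, while the minimum `s tanh s` over all functions is attained at
`cosh (s z) / cosh s`. Integrating the derivative of `s tanh (s z) φ²` gives the identity
`E(φ) = ∫₀¹ (φ' - s tanh (s z) φ)² + s tanh s φ(1)²` (`energy_eq_integral_sq_add_boundary`). Dropping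
the integral yields `q(s) ≤ s coth s` (`layerFun_le`). Lower bounds on `q` come from the
Cauchy–Schwarz inequality for `𝒜(s)` with a test profile (`sq_mul_sq_profile_le`): the constant
profile gives `1 ≤ q(s)`, and the Taylor polynomial of degree `2 N` of `cosh (s z)`, which is a
profile for both lists of exponents, has a defect `φ' - s tanh (s z) φ` of order `s ^ (2 N + 2)`. The
defect enters squared, which gives the order `4 N + 2` for `s ≤ 1`; for `s ≥ 1` the bound is trivial
since `s coth s - q(s) ≤ s`.
-/

namespace Kakinuma

open Matrix intervalIntegral

/-! ### The energy identity -/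

theorem hasDerivAt_tanh (x : ℝ) : HasDerivAt Real.tanh (1 - Real.tanh x ^ 2) x := by
  have hc : Real.cosh x ≠ 0 := (Real.cosh_pos x).ne'
  have h := (Real.hasDerivAt_sinh x).div (Real.hasDerivAt_cosh x) hc
  have heq : Real.tanh = Real.sinh / Real.cosh :=
    funext fun y => Real.tanh_eq_sinh_div_cosh y
  rw [heq]
  refine h.congr_deriv ?_
  rw [Pi.div_apply]
  field_simp

/-- The energy is a perfect square plus a boundary term: the difference of the integrands is the
derivative of `s tanh (s z) φ²`, since `φ' = s tanh (s z) φ` is the equation of `cosh (s z)`. -/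
theorem energy_eq_integral_sq_add_boundary {φ φ' : ℝ → ℝ} (hφ : ∀ z, HasDerivAt φ (φ' z) z)
    (hφ' : Continuous φ') (s : ℝ) :
    ∫ z in (0 : ℝ)..1, (φ' z ^ 2 + s ^ 2 * φ z ^ 2)
      = (∫ z in (0 : ℝ)..1, (φ' z - s * Real.tanh (s * z) * φ z) ^ 2)
        + s * Real.tanh s * φ 1 ^ 2 := by
  have hcφ : Continuous φ := continuous_iff_continuousAt.2 fun z => (hφ z).continuousAt
  have hct : Continuous Real.tanh :=
    continuous_iff_continuousAt.2 fun z => (hasDerivAt_tanh z).continuousAt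
  have hder : ∀ z, HasDerivAt (fun z => s * Real.tanh (s * z) * φ z ^ 2)
      (φ' z ^ 2 + s ^ 2 * φ z ^ 2 - (φ' z - s * Real.tanh (s * z) * φ z) ^ 2) z := by
    intro z
    have h1 : HasDerivAt (fun z => Real.tanh (s * z)) ((1 - Real.tanh (s * z) ^ 2) * (s * 1)) z :=
      (hasDerivAt_tanh (s * z)).comp z ((hasDerivAt_id z).const_mul s)
    refine ((h1.const_mul s).fun_mul ((hφ z).fun_pow 2)).congr_deriv ?_
    push_cast
    ring
  have hint := integral_eq_sub_of_hasDerivAt (a := 0) (b := 1) (fun z _ => hder z)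
    (Continuous.intervalIntegrable (by fun_prop) _ _)
  rw [intervalIntegral.integral_sub (Continuous.intervalIntegrable (by fun_prop) _ _)
    (Continuous.intervalIntegrable (by fun_prop) _ _)] at hint
  simp only [mul_one, mul_zero, Real.tanh_zero, zero_mul, sub_zero] at hint
  linarith

/-! ### The matrix of the energy -/

/-- The matrix `s² A₀ + A₁`, which is `𝒜(ξ)` for `|ξ| = s`. -/
noncomputable def layerMat {M : ℕ} (p : Fin (M + 1) → ℕ) (s : ℝ) :
    Matrix (Fin (M + 1)) (Fin (M + 1)) ℝ :=
  s ^ 2 • matA0 p + matA1 p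

theorem symbA_smul {M : ℕ} (p : Fin (M + 1) → ℕ) {n : ℕ} {h : ℝ} (hh : 0 < h)
    (ξ : EuclideanSpace ℝ (Fin n)) : symbA p (h • ξ) = layerMat p (h * ‖ξ‖) := by
  rw [symbA, layerMat, norm_smul, Real.norm_of_nonneg hh.le]

/-- The vertical profile `z ↦ ∑ cᵢ z ^ pᵢ`. -/
noncomputable def profile {M : ℕ} (p : Fin (M + 1) → ℕ) (c : Fin (M + 1) → ℝ) (z : ℝ) : ℝ :=
  ∑ i, c i * z ^ p i

/-- The derivative of `profile p c`. Truncated subtraction is harmless in the exponent: for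
`pᵢ = 0` the coefficient vanishes. -/
noncomputable def profileDeriv {M : ℕ} (p : Fin (M + 1) → ℕ) (c : Fin (M + 1) → ℝ) (z : ℝ) : ℝ :=
  ∑ i, c i * (p i * z ^ (p i - 1))

section

variable {M : ℕ} {p : Fin (M + 1) → ℕ}

theorem hasDerivAt_profile (c : Fin (M + 1) → ℝ) (z : ℝ) :
    HasDerivAt (profile p c) (profileDeriv p c z) z :=
  HasDerivAt.fun_sum fun i _ => (hasDerivAt_pow (p i) z).const_mul (c i)

theorem continuous_profile (c : Fin (M + 1) → ℝ) : Continuous (profile p c) := by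
  unfold profile; fun_prop

theorem continuous_profileDeriv (c : Fin (M + 1) → ℝ) : Continuous (profileDeriv p c) := by
  unfold profileDeriv; fun_prop

theorem profile_one (c : Fin (M + 1) → ℝ) : profile p c 1 = 1 ⬝ᵥ c := by
  simp [profile, dotProduct]

theorem integral_deriv_monomials (a b : ℕ) :
    ∫ z in (0 : ℝ)..1, ((a : ℝ) * z ^ (a - 1)) * (b * z ^ (b - 1))
      = (a : ℝ) * b / ((a : ℝ) + b - 1) := by
  rcases a with _ | a
  · simp
  rcases b with _ | b
  · simp
  have h : ∀ z : ℝ, (((a + 1 : ℕ) : ℝ) * z ^ (a + 1 - 1)) * ((b + 1 : ℕ) * z ^ (b + 1 - 1))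
      = ((a + 1 : ℕ) : ℝ) * (b + 1 : ℕ) * z ^ (a + b) := fun z => by
    simp only [Nat.add_sub_cancel]; ring
  simp only [h, intervalIntegral.integral_const_mul, integral_pow]
  push_cast
  simp only [one_pow, ne_eq, Nat.add_eq_zero_iff, one_ne_zero, and_false, not_false_eq_true,
    zero_pow, sub_zero]
  rw [show (a : ℝ) + 1 + (b + 1) - 1 = a + b + 1 by ring]
  ring

theorem integral_monomials (a b : ℕ) :
    ∫ z in (0 : ℝ)..1, z ^ a * z ^ b = 1 / ((a : ℝ) + b + 1) := by
  simp only [← pow_add, integral_pow]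
  simp

/-- The quadratic form of `s² A₀ + A₁` is the energy `∫₀¹ (φ'² + s² φ²)` of the profile. -/
theorem dotProduct_layerMat_mulVec (c : Fin (M + 1) → ℝ) (s : ℝ) :
    c ⬝ᵥ layerMat p s *ᵥ c
      = ∫ z in (0 : ℝ)..1, (profileDeriv p c z ^ 2 + s ^ 2 * profile p c z ^ 2) := by
  have hz : ∀ z : ℝ, profileDeriv p c z ^ 2 + s ^ 2 * profile p c z ^ 2
      = ∑ i, ∑ j, (c i * c j * (((p i : ℝ) * z ^ (p i - 1)) * (p j * z ^ (p j - 1)))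
        + c i * c j * s ^ 2 * (z ^ p i * z ^ p j)) := by
    intro z
    simp only [profileDeriv, profile, sq (Finset.sum _ _), Finset.sum_mul_sum]
    simp only [Finset.mul_sum, ← Finset.sum_add_distrib]
    refine Finset.sum_congr rfl fun i _ => Finset.sum_congr rfl fun j _ => ?_
    ring
  simp only [hz]
  rw [intervalIntegral.integral_finsetSum
    fun i _ => Continuous.intervalIntegrable (by fun_prop) _ _]
  simp only [dotProduct, mulVec, Finset.mul_sum]
  refine Finset.sum_congr rfl fun i _ => ?_
  rw [intervalIntegral.integral_finsetSum
    fun i _ => Continuous.intervalIntegrable (by fun_prop) _ _]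
  refine Finset.sum_congr rfl fun j _ => ?_
  rw [intervalIntegral.integral_add (Continuous.intervalIntegrable (by fun_prop) _ _)
    (Continuous.intervalIntegrable (by fun_prop) _ _)]
  rw [intervalIntegral.integral_const_mul, intervalIntegral.integral_const_mul,
    integral_deriv_monomials, integral_monomials]
  simp [layerMat, matA0, matA1]
  ring

/-- A polynomial with distinct exponents that vanishes on `[0, 1]` has zero coefficients. -/
theorem exists_profile_ne_zero (hp : Function.Injective p) {c : Fin (M + 1) → ℝ} (hc : c ≠ 0) :
    ∃ z ∈ Set.Icc (0 : ℝ) 1, profile p c z ≠ 0 := by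
  by_contra! h
  apply hc
  set P : Polynomial ℝ := ∑ i, Polynomial.monomial (p i) (c i) with hP
  have hP0 : P = 0 := by
    refine Polynomial.eq_zero_of_infinite_isRoot P
      ((Set.Icc_infinite (zero_lt_one (α := ℝ))).mono fun z hz => ?_)
    have := h z hz
    simpa [P, Polynomial.IsRoot, Polynomial.eval_finsetSum, profile] using this
  funext i
  have := congrArg (fun Q => Polynomial.coeff Q (p i)) hP0
  simpa [P, Polynomial.finsetSum_coeff, Polynomial.coeff_monomial, hp.eq_iff] using this

theorem layerMat_isHermitian (s : ℝ) : (layerMat p s).IsHermitian := by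
  ext i j
  simp [layerMat, matA0, matA1, add_comm (p i : ℝ), mul_comm (p i : ℝ)]

theorem layerMat_posDef (hp : Function.Injective p) {s : ℝ} (hs : 0 < s) :
    (layerMat p s).PosDef := by
  refine .of_dotProduct_mulVec_pos (layerMat_isHermitian s) fun c hc => ?_
  rw [star_trivial, dotProduct_layerMat_mulVec]
  obtain ⟨z, hz, hne⟩ := exists_profile_ne_zero hp hc
  have h1 := continuous_profile (p := p) c
  have h2 := continuous_profileDeriv (p := p) c
  exact integral_pos one_pos (by fun_prop) (fun _ _ => by positivity) ⟨z, hz, by positivity⟩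

/-! ### The layer function -/

/-- The layer function `q(s) = s² 1ᵀ 𝒜⁻¹ 1`, the counterpart of `s coth s` in the dispersion
relation of the Kakinuma model. -/
noncomputable def layerFun (p : Fin (M + 1) → ℕ) (s : ℝ) : ℝ :=
  s ^ 2 * (1 ⬝ᵥ (layerMat p s)⁻¹ *ᵥ 1)

theorem det_bordered {A : Matrix (Fin (M + 1)) (Fin (M + 1)) ℝ} (hA : IsUnit A.det) :
    (bordered A).det = A.det * (1 ⬝ᵥ A⁻¹ *ᵥ 1) := by
  have := A.invertibleOfIsUnitDet hA
  rw [bordered, det_fromBlocks₂₂, det_unique (n := Unit), invOf_eq_nonsing_inv]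
  congr 1
  simp only [Matrix.sub_apply, Matrix.zero_apply, Matrix.mul_apply, dotProduct, mulVec,
    Matrix.of_apply, Pi.one_apply]
  simp only [one_mul, mul_neg, mul_one, Finset.sum_neg_distrib, zero_sub, neg_neg]
  exact Finset.sum_comm

/-- The Cauchy–Schwarz inequality for the inner product of a positive definite matrix. -/
theorem sq_dotProduct_le {A : Matrix (Fin (M + 1)) (Fin (M + 1)) ℝ} (hA : A.PosDef)
    {b : Fin (M + 1) → ℝ} (hb : b ≠ 0) (c : Fin (M + 1) → ℝ) :
    (b ⬝ᵥ c) ^ 2 ≤ (b ⬝ᵥ A⁻¹ *ᵥ b) * (c ⬝ᵥ A *ᵥ c) := by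
  have hB : 0 < b ⬝ᵥ A⁻¹ *ᵥ b := by simpa using hA.inv.dotProduct_mulVec_pos hb
  set w := A⁻¹ *ᵥ b with hw
  have hAw : A *ᵥ w = b := by
    rw [hw, mulVec_mulVec, mul_nonsing_inv _ hA.det_pos.ne'.isUnit, one_mulVec]
  have hsymm : w ⬝ᵥ A *ᵥ c = b ⬝ᵥ c := by
    have hT : Aᵀ = A := by simpa using hA.isHermitian.eq
    rw [dotProduct_mulVec, ← mulVec_transpose, hT, hAw]
  -- Up to scaling, `(b ⬝ᵥ w) • c - (b ⬝ᵥ c) • w` is the component of `c` orthogonal to `w`.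
  have h0 : 0 ≤ ((b ⬝ᵥ w) • c - (b ⬝ᵥ c) • w) ⬝ᵥ A *ᵥ ((b ⬝ᵥ w) • c - (b ⬝ᵥ c) • w) := by
    simpa using hA.posSemidef.dotProduct_mulVec_nonneg ((b ⬝ᵥ w) • c - (b ⬝ᵥ c) • w)
  simp only [mulVec_sub, mulVec_smul, hAw, dotProduct_sub, sub_dotProduct, smul_dotProduct,
    dotProduct_smul, smul_eq_mul, hsymm, dotProduct_comm c b, dotProduct_comm w b] at h0
  have h1 : 0 ≤ (b ⬝ᵥ w) * ((b ⬝ᵥ w) * (c ⬝ᵥ A *ᵥ c) - (b ⬝ᵥ c) ^ 2) := by linarith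
  linarith [nonneg_of_mul_nonneg_right h1 hB]

/-- Testing with an arbitrary profile bounds the layer function from below. -/
theorem sq_mul_sq_profile_le (hp : Function.Injective p) {s : ℝ} (hs : 0 < s)
    (c : Fin (M + 1) → ℝ) :
    s ^ 2 * profile p c 1 ^ 2
      ≤ layerFun p s
        * ∫ z in (0 : ℝ)..1, (profileDeriv p c z ^ 2 + s ^ 2 * profile p c z ^ 2) := by
  rw [profile_one, ← dotProduct_layerMat_mulVec, layerFun, mul_assoc]
  exact mul_le_mul_of_nonneg_left (sq_dotProduct_le (layerMat_posDef hp hs) one_ne_zero c)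
    (sq_nonneg s)

theorem one_le_layerFun (hp : Function.Injective p) {i₀ : Fin (M + 1)} (hi₀ : p i₀ = 0)
    {s : ℝ} (hs : 0 < s) : 1 ≤ layerFun p s := by
  -- The test profile is the constant function one.
  have h := sq_mul_sq_profile_le hp hs (Pi.single i₀ 1)
  have h1 : ∀ z, profile p (Pi.single i₀ 1) z = 1 := fun z => by
    simp [profile, Pi.single_apply, hi₀]
  have h2 : ∀ z, profileDeriv p (Pi.single i₀ 1) z = 0 := fun z => by
    simp [profileDeriv, Pi.single_apply, hi₀]
  simp only [h1, h2] at h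
  simp at h
  have : 0 < s ^ 2 := by positivity
  nlinarith

theorem mul_tanh_pos {s : ℝ} (hs : 0 < s) : 0 < s * Real.tanh s := by
  rw [Real.tanh_eq_sinh_div_cosh]
  have := Real.sinh_pos_iff.2 hs
  have := Real.cosh_pos s
  positivity

theorem mul_coth_mul_mul_tanh {s : ℝ} (hs : 0 < s) :
    s * coth s * (s * Real.tanh s) = s ^ 2 := by
  rw [Real.tanh_eq_sinh_div_cosh, coth]
  have := (Real.sinh_pos_iff.2 hs).ne'
  have := (Real.cosh_pos s).ne'
  field_simp

/-- The Kakinuma energy minimum exceeds the true one. For `w = 𝒜⁻¹ 1` the energy of the profile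
and its value at `z = 1` coincide, so the boundary term of the energy identity bounds that value. -/
theorem layerFun_le (hp : Function.Injective p) {s : ℝ} (hs : 0 < s) :
    layerFun p s ≤ s * coth s := by
  have hpos := layerMat_posDef hp hs
  set w := (layerMat p s)⁻¹ *ᵥ (1 : Fin (M + 1) → ℝ) with hw
  have hw1 : 0 < 1 ⬝ᵥ w := by simpa using hpos.inv.dotProduct_mulVec_pos (one_ne_zero)
  have hAw : layerMat p s *ᵥ w = 1 := by
    rw [hw, mulVec_mulVec, mul_nonsing_inv _ hpos.det_pos.ne'.isUnit, one_mulVec]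
  have h := dotProduct_layerMat_mulVec (p := p) w s
  rw [energy_eq_integral_sq_add_boundary (hasDerivAt_profile w) (continuous_profileDeriv w),
    profile_one, hAw, dotProduct_comm] at h
  have hG : 0 ≤ ∫ z in (0 : ℝ)..1, (profileDeriv p w z
      - s * Real.tanh (s * z) * profile p w z) ^ 2 :=
    integral_nonneg zero_le_one fun _ _ => sq_nonneg _
  have hle : s * Real.tanh s * (1 ⬝ᵥ w) ≤ 1 := by
    by_contra! hlt
    nlinarith
  have hf := mul_coth_mul_mul_tanh hs
  have ht := mul_tanh_pos hs
  have hf0 : 0 < s * coth s := by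
    by_contra! hlt
    nlinarith [sq_pos_of_pos hs]
  calc layerFun p s = s * coth s * (s * Real.tanh s * (1 ⬝ᵥ w)) := by
        rw [layerFun, ← hf]; ring
    _ ≤ s * coth s * 1 := by gcongr
    _ = s * coth s := mul_one _

end

theorem mul_coth_le {s : ℝ} (hs : 0 < s) : s * coth s ≤ 1 + s := by
  have hsh := Real.sinh_pos_iff.2 hs
  have h1 := Real.self_le_sinh_iff.2 hs.le
  have h2 : Real.exp (-s) ≤ 1 := Real.exp_le_one_iff.2 (by linarith)
  rw [coth, ← mul_div_assoc, div_le_iff₀ hsh]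
  have h3 := Real.cosh_sub_sinh s
  nlinarith

/-! ### Taylor polynomials of the hyperbolic functions -/

/-- The Taylor polynomial of `cosh` of degree `2 N`. -/
noncomputable def coshTaylor (N : ℕ) (x : ℝ) : ℝ :=
  ∑ k ∈ Finset.range (N + 1), x ^ (2 * k) / ((2 * k).factorial : ℝ)

/-- The Taylor polynomial of `sinh` of degree `2 N - 1` (zero for `N = 0`). -/
noncomputable def sinhTaylor (N : ℕ) (x : ℝ) : ℝ :=
  ∑ k ∈ Finset.range N, x ^ (2 * k + 1) / ((2 * k + 1).factorial : ℝ)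

theorem hasDerivAt_coshTaylor (N : ℕ) (x : ℝ) :
    HasDerivAt (coshTaylor N) (sinhTaylor N x) x := by
  have h : coshTaylor N = fun x => (∑ k ∈ Finset.range N,
      x ^ (2 * k + 1 + 1) / ((2 * k + 1 + 1).factorial : ℝ)) + 1 := by
    funext x
    simp [coshTaylor, Finset.sum_range_succ', mul_add]
  rw [h]
  refine (HasDerivAt.fun_sum fun k _ => ?_).add_const 1
  refine ((hasDerivAt_pow (2 * k + 1 + 1) x).div_const
    ((2 * k + 1 + 1).factorial : ℝ)).congr_deriv ?_
  rw [Nat.factorial_succ (2 * k + 1), Nat.add_sub_cancel]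
  have : ((2 * k + 1).factorial : ℝ) ≠ 0 := by positivity
  push_cast
  field_simp

theorem one_le_coshTaylor (N : ℕ) (x : ℝ) : 1 ≤ coshTaylor N x := by
  rw [coshTaylor, Finset.sum_range_succ']
  have : 0 ≤ ∑ k ∈ Finset.range N, x ^ (2 * (k + 1)) / ((2 * (k + 1)).factorial : ℝ) :=
    Finset.sum_nonneg fun k _ => div_nonneg ((even_two_mul _).pow_nonneg x) (Nat.cast_nonneg _)
  simpa using this

theorem cosh_sub_coshTaylor_mem (N : ℕ) {x : ℝ} (hx : 0 ≤ x) :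
    Real.cosh x - coshTaylor N x ∈ Set.Icc 0 (x ^ (2 * N + 2) * Real.cosh x) := by
  have h := (hasSum_nat_add_iff' (N + 1)).2 (Real.hasSum_cosh x)
  refine ⟨h.nonneg fun n => by positivity,
    hasSum_le (fun n => ?_) h ((Real.hasSum_cosh x).mul_left (x ^ (2 * N + 2)))⟩
  rw [mul_div_assoc', ← pow_add, show 2 * N + 2 + 2 * n = 2 * (n + (N + 1)) by ring]
  gcongr
  omega

theorem sinh_sub_sinhTaylor_mem (N : ℕ) {x : ℝ} (hx : 0 ≤ x) :
    Real.sinh x - sinhTaylor N x ∈ Set.Icc 0 (x ^ (2 * N + 1) * Real.cosh x) := by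
  have h := (hasSum_nat_add_iff' N).2 (Real.hasSum_sinh x)
  refine ⟨h.nonneg fun n => by positivity,
    hasSum_le (fun n => ?_) h ((Real.hasSum_cosh x).mul_left (x ^ (2 * N + 1)))⟩
  rw [mul_div_assoc', ← pow_add, show 2 * N + 1 + 2 * n = 2 * (n + N) + 1 by ring]
  gcongr
  omega

/-- The Taylor polynomials satisfy the first-order equation `u' = tanh · u` of `cosh` up to a
remainder of order `2 N + 1`. -/
theorem abs_sinhTaylor_sub_le (N : ℕ) {x : ℝ} (hx : 0 ≤ x) (hx1 : x ≤ 1) :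
    |sinhTaylor N x - Real.tanh x * coshTaylor N x| ≤ x ^ (2 * N + 1) * Real.cosh x := by
  obtain ⟨hR0, hR⟩ := cosh_sub_coshTaylor_mem N hx
  obtain ⟨hQ0, hQ⟩ := sinh_sub_sinhTaylor_mem N hx
  have ht0 : 0 ≤ Real.tanh x := by
    rw [Real.tanh_eq_sinh_div_cosh]
    exact div_nonneg (Real.sinh_nonneg_iff.2 hx) (Real.cosh_pos x).le
  have ht1 : Real.tanh x ≤ 1 := (Real.tanh_lt_one x).le
  have hsc : Real.tanh x * Real.cosh x = Real.sinh x := by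
    rw [Real.tanh_eq_sinh_div_cosh, div_mul_cancel₀ _ (Real.cosh_pos x).ne']
  have hpow : x ^ (2 * N + 2) * Real.cosh x ≤ x ^ (2 * N + 1) * Real.cosh x :=
    mul_le_mul_of_nonneg_right (pow_le_pow_of_le_one hx hx1 (by omega)) (Real.cosh_pos x).le
  have hmul : Real.tanh x * (Real.cosh x - coshTaylor N x) ≤ Real.cosh x - coshTaylor N x :=
    mul_le_of_le_one_left hR0 ht1
  have hmul0 := mul_nonneg ht0 hR0
  rw [abs_le]
  constructor <;> nlinarith

/-! ### Accuracy of the layer function -/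

/-- The exponents `p` are distinct and contain `0, 2, …, 2N`: up to a scaling of the variable, the
profiles then include the Taylor polynomial of `cosh` of degree `2N`. -/
structure ContainsEven (N : ℕ) {M : ℕ} (p : Fin (M + 1) → ℕ) : Prop where
  injective : Function.Injective p
  exists_index : ∃ σ : Fin (N + 1) → Fin (M + 1), ∀ k, p (σ k) = 2 * (k : ℕ)

theorem containsEven_of_eq {N M : ℕ} {p : Fin (M + 1) → ℕ}
    (h : (M = N ∧ ∀ i, p i = 2 * (i : ℕ)) ∨ (M = 2 * N ∧ ∀ i, p i = (i : ℕ))) :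
    ContainsEven N p := by
  rcases h with ⟨rfl, h⟩ | ⟨rfl, h⟩
  · exact ⟨fun i j hij => Fin.ext (by simp only [h] at hij; omega), id, h⟩
  · exact ⟨fun i j hij => Fin.ext (by simpa only [h] using hij),
      fun k => ⟨2 * (k : ℕ), by omega⟩, fun k => h _⟩

theorem containsEven_evenExp (N : ℕ) : ContainsEven N (evenExp N) :=
  containsEven_of_eq (.inl ⟨rfl, fun _ => rfl⟩)

section

variable {N M : ℕ} {p : Fin (M + 1) → ℕ}

theorem ContainsEven.exists_profile_eq (hp : ContainsEven N p) (s : ℝ) :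
    ∃ c, profile p c = fun z => coshTaylor N (s * z) := by
  obtain ⟨σ, hσ⟩ := hp.exists_index
  refine ⟨fun i => ∑ k : Fin (N + 1),
    if σ k = i then s ^ (2 * (k : ℕ)) / ((2 * (k : ℕ)).factorial : ℝ) else 0, funext fun z => ?_⟩
  simp only [profile, Finset.sum_mul, ite_mul, zero_mul]
  rw [Finset.sum_comm, coshTaylor,
    ← Fin.sum_univ_eq_sum_range fun k => (s * z) ^ (2 * k) / ((2 * k).factorial : ℝ)]
  refine Finset.sum_congr rfl fun k _ => ?_
  rw [Finset.sum_ite_eq, if_pos (Finset.mem_univ _), hσ, mul_pow]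
  ring

theorem ContainsEven.one_le_layerFun (hp : ContainsEven N p) {s : ℝ} (hs : 0 < s) :
    1 ≤ layerFun p s := by
  obtain ⟨σ, hσ⟩ := hp.exists_index
  exact Kakinuma.one_le_layerFun hp.injective (hσ 0) hs

/-- The defect `φ' - s tanh(s z) φ` of the Taylor profile is of order `s ^ (2 N + 2)`, so that its
square contributes only at order `4 N + 4` to the energy. -/
theorem integral_defect_le (N : ℕ) {s : ℝ} (hs : 0 < s) (hs1 : s ≤ 1) :
    ∫ z in (0 : ℝ)..1, (s * sinhTaylor N (s * z)
        - s * Real.tanh (s * z) * coshTaylor N (s * z)) ^ 2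
      ≤ Real.cosh 1 ^ 2 * s ^ (4 * N + 4) := by
  have hcC : Continuous (coshTaylor N) := by unfold coshTaylor; fun_prop
  have hcS : Continuous (sinhTaylor N) := by unfold sinhTaylor; fun_prop
  have hct : Continuous Real.tanh :=
    continuous_iff_continuousAt.2 fun z => (hasDerivAt_tanh z).continuousAt
  have hpt : ∀ z ∈ Set.Icc (0 : ℝ) 1, (s * sinhTaylor N (s * z)
        - s * Real.tanh (s * z) * coshTaylor N (s * z)) ^ 2
      ≤ Real.cosh 1 ^ 2 * s ^ (4 * N + 4) := by
    intro z hz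
    have hx0 : 0 ≤ s * z := mul_nonneg hs.le hz.1
    have hxs : s * z ≤ s := mul_le_of_le_one_right hs.le hz.2
    have hx1 : s * z ≤ 1 := hxs.trans hs1
    have hch : Real.cosh (s * z) ≤ Real.cosh 1 :=
      Real.cosh_le_cosh.2 (by rwa [abs_of_nonneg hx0, abs_one])
    have hle : |s * sinhTaylor N (s * z) - s * Real.tanh (s * z) * coshTaylor N (s * z)|
        ≤ s * (s ^ (2 * N + 1) * Real.cosh 1) := by
      rw [mul_assoc, ← mul_sub, abs_mul, abs_of_pos hs]
      have hcosh := Real.cosh_pos (s * z)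
      refine mul_le_mul_of_nonneg_left ((abs_sinhTaylor_sub_le N hx0 hx1).trans ?_) hs.le
      gcongr
    calc _ ≤ (s * (s ^ (2 * N + 1) * Real.cosh 1)) ^ 2 :=
          sq_le_sq' (abs_le.1 hle).1 (abs_le.1 hle).2
      _ = Real.cosh 1 ^ 2 * s ^ (4 * N + 4) := by ring
  have := intervalIntegral.integral_mono_on (μ := MeasureTheory.volume) zero_le_one
    (Continuous.intervalIntegrable (by fun_prop) _ _)
    (Continuous.intervalIntegrable continuous_const _ _) hpt
  simpa using this

theorem ContainsEven.mul_coth_sub_layerFun_le_of_le_one (hp : ContainsEven N p) {s : ℝ}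
    (hs : 0 < s) (hs1 : s ≤ 1) :
    s * coth s - layerFun p s ≤ 4 * Real.cosh 1 ^ 2 * s ^ (4 * N + 2) := by
  obtain ⟨c, hc⟩ := hp.exists_profile_eq s
  have hder : ∀ z, profileDeriv p c z = s * sinhTaylor N (s * z) := fun z => by
    have h1 : HasDerivAt (fun z => coshTaylor N (s * z)) (sinhTaylor N (s * z) * (s * 1)) z :=
      (hasDerivAt_coshTaylor N (s * z)).comp z ((hasDerivAt_id z).const_mul s)
    rw [← hc] at h1
    rw [(hasDerivAt_profile c z).unique h1]
    ring
  have hq := sq_mul_sq_profile_le hp.injective hs c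
  have hE := energy_eq_integral_sq_add_boundary (hasDerivAt_profile (p := p) c)
    (continuous_profileDeriv c) s
  have hG := integral_defect_le N hs hs1
  have hG0 : 0 ≤ ∫ z in (0 : ℝ)..1, (profileDeriv p c z
      - s * Real.tanh (s * z) * profile p c z) ^ 2 :=
    integral_nonneg zero_le_one fun _ _ => sq_nonneg _
  have hT : 1 ≤ profile p c 1 ^ 2 := by
    rw [hc]
    exact one_le_pow₀ (one_le_coshTaylor N _)
  have hGeq : (∫ z in (0 : ℝ)..1, (profileDeriv p c z
      - s * Real.tanh (s * z) * profile p c z) ^ 2) ≤ Real.cosh 1 ^ 2 * s ^ (4 * N + 4) := by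
    simpa only [hder, hc] using hG
  set E := ∫ z in (0 : ℝ)..1, (profileDeriv p c z ^ 2 + s ^ 2 * profile p c z ^ 2)
  set G := ∫ z in (0 : ℝ)..1, (profileDeriv p c z - s * Real.tanh (s * z) * profile p c z) ^ 2
  set T := profile p c 1
  set f := s * coth s with hf
  have hft := mul_coth_mul_mul_tanh hs
  have ht := mul_tanh_pos hs
  rw [← hf] at hft
  have hf1 : 1 ≤ f := (hp.one_le_layerFun hs).trans (layerFun_le hp.injective hs)
  have hf2 : f ≤ 2 := (mul_coth_le hs).trans (by linarith)
  have hEpos : 0 < E := by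
    have := mul_le_mul_of_nonneg_left hT ht.le
    linarith
  -- `f E = f G + s² T²`, and `f E ≥ s²` makes the quotient by `E` harmless.
  have hfE : f * E = f * G + s ^ 2 * T ^ 2 := by rw [hE, ← hft]; ring
  have h1 : (f - layerFun p s) * E ≤ f * G := by linarith
  have h2 : s ^ 2 ≤ f * E := by
    have := mul_le_mul_of_nonneg_left hT (sq_nonneg s)
    nlinarith
  refine le_of_mul_le_mul_right (h1.trans ?_) hEpos
  have hs4 : (0 : ℝ) ≤ s ^ (4 * N + 2) := by positivity
  calc f * G ≤ f * (Real.cosh 1 ^ 2 * s ^ (4 * N + 4)) := by gcongr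
    _ = f * (Real.cosh 1 ^ 2 * s ^ (4 * N + 2)) * s ^ 2 := by ring
    _ ≤ f * (Real.cosh 1 ^ 2 * s ^ (4 * N + 2)) * (f * E) := by gcongr
    _ = f ^ 2 * (Real.cosh 1 ^ 2 * s ^ (4 * N + 2) * E) := by ring
    _ ≤ 2 ^ 2 * (Real.cosh 1 ^ 2 * s ^ (4 * N + 2) * E) := by gcongr
    _ = 4 * Real.cosh 1 ^ 2 * s ^ (4 * N + 2) * E := by ring

theorem ContainsEven.mul_coth_sub_layerFun_le (hp : ContainsEven N p) {s : ℝ} (hs : 0 < s) :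
    s * coth s - layerFun p s ≤ 4 * Real.cosh 1 ^ 2 * s ^ (4 * N + 2) := by
  rcases le_total s 1 with h | h
  · exact hp.mul_coth_sub_layerFun_le_of_le_one hs h
  have h1 := mul_coth_le hs
  have h2 := hp.one_le_layerFun hs
  -- For `s ≥ 1` the left-hand side is at most `(1 + s) - 1`.
  have h3 : s ≤ s ^ (4 * N + 2) := le_self_pow₀ h (by omega)
  have h4 : (1 : ℝ) ≤ Real.cosh 1 ^ 2 := one_le_pow₀ (Real.one_le_cosh 1)
  nlinarith

end

/-! ### The phase speeds as functions of the layer functions -/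

section

variable {N M n : ℕ} {p : Fin (M + 1) → ℕ} {ρ₁ ρ₂ h₁ h₂ g : ℝ}

/-- The factors `1` are the common limit of the layer functions as `ξ → 0`. -/
theorem cSWsq_eq (hh₁ : 0 < h₁) (hh₂ : 0 < h₂) :
    cSWsq ρ₁ ρ₂ h₁ h₂ g = (ρ₂ - ρ₁) * g / (ρ₁ / h₁ * 1 + ρ₂ / h₂ * 1) := by
  rw [cSWsq]
  field_simp

theorem cIWsq_eq (hh₁ : 0 < h₁) (hh₂ : 0 < h₂) {ξ : EuclideanSpace ℝ (Fin n)} (hξ : ξ ≠ 0) :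
    cIWsq ρ₁ ρ₂ h₁ h₂ g ξ = (ρ₂ - ρ₁) * g /
      (ρ₁ / h₁ * (h₁ * ‖ξ‖ * coth (h₁ * ‖ξ‖)) + ρ₂ / h₂ * (h₂ * ‖ξ‖ * coth (h₂ * ‖ξ‖))) := by
  rw [cIWsq, if_neg hξ]
  congr 1
  field_simp

/-- The bordered determinants factor through the layer functions. -/
theorem dispCoeff_mul_norm_sq (hp : ContainsEven N p) (hh₁ : 0 < h₁) (hh₂ : 0 < h₂)
    {ξ : EuclideanSpace ℝ (Fin n)} (hξ : ξ ≠ 0) :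
    dispCoeff N p ρ₁ ρ₂ h₁ h₂ ξ * ‖ξ‖ ^ 2
      = (symbA (evenExp N) (h₁ • ξ)).det * (symbA p (h₂ • ξ)).det *
        (ρ₁ / h₁ * layerFun (evenExp N) (h₁ * ‖ξ‖) + ρ₂ / h₂ * layerFun p (h₂ * ‖ξ‖)) := by
  have hr : 0 < ‖ξ‖ := norm_pos_iff.2 hξ
  have hD₁ := (layerMat_posDef (containsEven_evenExp N).injective (mul_pos hh₁ hr)).det_pos
  have hD₂ := (layerMat_posDef hp.injective (mul_pos hh₂ hr)).det_pos
  rw [dispCoeff, symbA_smul _ hh₁, symbA_smul _ hh₂, det_bordered hD₁.ne'.isUnit,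
    det_bordered hD₂.ne'.isUnit, layerFun, layerFun]
  field_simp

theorem det_symbA_pos (hp : ContainsEven N p) {h : ℝ} (hh : 0 < h)
    {ξ : EuclideanSpace ℝ (Fin n)} (hξ : ξ ≠ 0) : 0 < (symbA p (h • ξ)).det := by
  rw [symbA_smul _ hh]
  exact (layerMat_posDef hp.injective (mul_pos hh (norm_pos_iff.2 hξ))).det_pos

theorem dispCoeff_pos (hp : ContainsEven N p) (hρ₁ : 0 < ρ₁) (hρ₂ : 0 < ρ₂) (hh₁ : 0 < h₁)
    (hh₂ : 0 < h₂) {ξ : EuclideanSpace ℝ (Fin n)} (hξ : ξ ≠ 0) :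
    0 < dispCoeff N p ρ₁ ρ₂ h₁ h₂ ξ := by
  have hr : 0 < ‖ξ‖ := norm_pos_iff.2 hξ
  have hq₁ := (containsEven_evenExp N).one_le_layerFun (mul_pos hh₁ hr)
  have hq₂ := hp.one_le_layerFun (mul_pos hh₂ hr)
  have hD₁ := det_symbA_pos (containsEven_evenExp N) hh₁ hξ
  have hD₂ := det_symbA_pos hp hh₂ hξ
  refine pos_of_mul_pos_left ?_ (sq_nonneg ‖ξ‖)
  rw [dispCoeff_mul_norm_sq hp hh₁ hh₂ hξ]
  positivity

theorem cKsq_eq (hp : ContainsEven N p) (hρ₁ : 0 < ρ₁) (hρ₂ : 0 < ρ₂) (hh₁ : 0 < h₁)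
    (hh₂ : 0 < h₂) {ξ : EuclideanSpace ℝ (Fin n)} (hξ : ξ ≠ 0) :
    cKsq N p ρ₁ ρ₂ h₁ h₂ g ξ = (ρ₂ - ρ₁) * g /
      (ρ₁ / h₁ * layerFun (evenExp N) (h₁ * ‖ξ‖) + ρ₂ / h₂ * layerFun p (h₂ * ‖ξ‖)) := by
  have hr : 0 < ‖ξ‖ := norm_pos_iff.2 hξ
  have hq₁ := (containsEven_evenExp N).one_le_layerFun (mul_pos hh₁ hr)
  have hq₂ := hp.one_le_layerFun (mul_pos hh₂ hr)
  have hS : 0 < ρ₁ / h₁ * layerFun (evenExp N) (h₁ * ‖ξ‖) + ρ₂ / h₂ * layerFun p (h₂ * ‖ξ‖) := by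
    positivity
  have hD := dispCoeff_pos hp hρ₁ hρ₂ hh₁ hh₂ hξ
  have h := dispCoeff_mul_norm_sq (ρ₁ := ρ₁) (ρ₂ := ρ₂) hp hh₁ hh₂ hξ
  rw [cKsq, if_neg hξ, div_eq_div_iff hD.ne' hS.ne']
  have hrr : (‖ξ‖ ^ 2)⁻¹ * ‖ξ‖ ^ 2 = 1 := inv_mul_cancel₀ (by positivity)
  linear_combination (-(ρ₂ - ρ₁) * g * (‖ξ‖ ^ 2)⁻¹) * h
    + (ρ₂ - ρ₁) * g * dispCoeff N p ρ₁ ρ₂ h₁ h₂ ξ * hrr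

end

/-- If `y₁, y₂` deviate from one by `O(|x|)`, then `k / (a₁ y₁ + a₂ y₂)` is continuous at zero. -/
theorem continuousAt_zero_of_weighted {E : Type*} [SeminormedAddCommGroup E] {c : E → ℝ}
    {k a₁ a₂ b₁ b₂ : ℝ} (ha₁ : 0 < a₁) (ha₂ : 0 < a₂)
    (h : ∀ x, ∃ y₁ ∈ Set.Icc 1 (1 + b₁ * ‖x‖), ∃ y₂ ∈ Set.Icc 1 (1 + b₂ * ‖x‖),
      c x = k / (a₁ * y₁ + a₂ * y₂)) : ContinuousAt c 0 := by
  choose y₁ hy₁ y₂ hy₂ hc using h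
  have key : ∀ {y : E → ℝ} {b : ℝ}, (∀ x, y x ∈ Set.Icc 1 (1 + b * ‖x‖)) →
      ContinuousAt y 0 := by
    intro y b hy
    have h0 : y 0 = 1 := le_antisymm (by simpa using (hy 0).2) (hy 0).1
    have hlim : Filter.Tendsto (fun x : E => 1 + b * ‖x‖) (nhds 0) (nhds 1) :=
      Continuous.tendsto' (by fun_prop) _ _ (by simp)
    rw [ContinuousAt, h0]
    exact tendsto_of_tendsto_of_tendsto_of_le_of_le tendsto_const_nhds hlim
      (fun x => (hy x).1) fun x => (hy x).2
  have hpos : a₁ * y₁ 0 + a₂ * y₂ 0 ≠ 0 := by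
    have h₁ := (hy₁ 0).1
    have h₂ := (hy₂ 0).1
    positivity
  rw [funext hc]
  exact continuousAt_const.div
    ((continuousAt_const.mul (key hy₁)).add (continuousAt_const.mul (key hy₂))) hpos

theorem abs_weighted_sub_le {a₁ a₂ f₁ f₂ q₁ q₂ δ : ℝ} (ha₁ : 0 < a₁) (ha₂ : 0 < a₂)
    (hq₁ : 1 ≤ q₁) (hq₂ : 1 ≤ q₂) (hf₁ : q₁ ≤ f₁) (hf₂ : q₂ ≤ f₂) (hδ₁ : f₁ - q₁ ≤ δ)
    (hδ₂ : f₂ - q₂ ≤ δ) :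
    |(a₁ + a₂) / (a₁ * f₁ + a₂ * f₂) - (a₁ + a₂) / (a₁ * q₁ + a₂ * q₂)| ≤ δ := by
  have hA : 0 < a₁ + a₂ := add_pos ha₁ ha₂
  have hq : a₁ + a₂ ≤ a₁ * q₁ + a₂ * q₂ := by nlinarith
  have hf : a₁ * q₁ + a₂ * q₂ ≤ a₁ * f₁ + a₂ * f₂ := by nlinarith
  have hd : (a₁ * f₁ + a₂ * f₂) - (a₁ * q₁ + a₂ * q₂) ≤ (a₁ + a₂) * δ := by nlinarith
  have hδ : 0 ≤ δ := by linarith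
  set A := a₁ + a₂
  set Q := a₁ * q₁ + a₂ * q₂
  set F := a₁ * f₁ + a₂ * f₂
  have hQ : 0 < Q := by linarith
  have hF : 0 < F := by linarith
  rw [abs_sub_comm, abs_of_nonneg (sub_nonneg.2 (div_le_div_of_nonneg_left hA.le hQ hf)),
    div_sub_div _ _ hQ.ne' hF.ne', div_le_iff₀ (mul_pos hQ hF)]
  calc A * F - Q * A = A * (F - Q) := by ring
    _ ≤ A * (A * δ) := by gcongr
    _ = δ * (A * A) := by ring
    _ ≤ δ * (Q * F) := by gcongr; linarith

end Kakinuma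

open Kakinuma

theorem mainTheorem3 (N : ℕ) :
    ∃ C : ℝ, 0 < C ∧
      ∀ (M : ℕ) (p : Fin (M + 1) → ℕ),
        ((M = N ∧ ∀ i, p i = 2 * (i : ℕ)) ∨ (M = 2 * N ∧ ∀ i, p i = (i : ℕ))) →
      ∀ (n : ℕ) (ρ₁ ρ₂ h₁ h₂ g : ℝ), 0 < ρ₁ → ρ₁ < ρ₂ → 0 < h₁ → 0 < h₂ → 0 < g →
        -- the squared phase speeds are well defined off the origin and extend continuously to it
        (∀ ξ : EuclideanSpace ℝ (Fin n), ξ ≠ 0 → 0 < Kakinuma.dispCoeff N p ρ₁ ρ₂ h₁ h₂ ξ) ∧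
        ContinuousAt
          (fun ξ : EuclideanSpace ℝ (Fin n) => Kakinuma.cIWsq ρ₁ ρ₂ h₁ h₂ g ξ) 0 ∧
        ContinuousAt
          (fun ξ : EuclideanSpace ℝ (Fin n) => Kakinuma.cKsq N p ρ₁ ρ₂ h₁ h₂ g ξ) 0 ∧
        ∀ ξ : EuclideanSpace ℝ (Fin n),
          |Kakinuma.cIWsq ρ₁ ρ₂ h₁ h₂ g ξ / Kakinuma.cSWsq ρ₁ ρ₂ h₁ h₂ g
              - Kakinuma.cKsq N p ρ₁ ρ₂ h₁ h₂ g ξ / Kakinuma.cSWsq ρ₁ ρ₂ h₁ h₂ g|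
            ≤ C * (h₁ * ‖ξ‖ + h₂ * ‖ξ‖) ^ (4 * N + 2) := by
  refine ⟨4 * Real.cosh 1 ^ 2, mul_pos four_pos (pow_pos (Real.cosh_pos 1) 2), ?_⟩
  intro M p hMp n ρ₁ ρ₂ h₁ h₂ g hρ₁ hρ hh₁ hh₂ hg
  have hρ₂ : 0 < ρ₂ := hρ₁.trans hρ
  have ha₁ : 0 < ρ₁ / h₁ := div_pos hρ₁ hh₁
  have ha₂ : 0 < ρ₂ / h₂ := div_pos hρ₂ hh₂
  have hp := containsEven_of_eq hMp
  have he := containsEven_evenExp N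
  refine ⟨fun ξ hξ => dispCoeff_pos hp hρ₁ hρ₂ hh₁ hh₂ hξ,
    continuousAt_zero_of_weighted (k := (ρ₂ - ρ₁) * g) (b₁ := h₁) (b₂ := h₂)
      ha₁ ha₂ fun ξ => ?_,
    continuousAt_zero_of_weighted (k := (ρ₂ - ρ₁) * g) (b₁ := h₁) (b₂ := h₂)
      ha₁ ha₂ fun ξ => ?_, fun ξ => ?_⟩
  · rcases eq_or_ne ξ 0 with rfl | hξ
    · exact ⟨1, by simp, 1, by simp, by rw [cIWsq, if_pos rfl, cSWsq_eq hh₁ hh₂]⟩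
    have hs₁ : 0 < h₁ * ‖ξ‖ := mul_pos hh₁ (norm_pos_iff.2 hξ)
    have hs₂ : 0 < h₂ * ‖ξ‖ := mul_pos hh₂ (norm_pos_iff.2 hξ)
    exact ⟨_, ⟨(he.one_le_layerFun hs₁).trans (layerFun_le he.injective hs₁), mul_coth_le hs₁⟩,
      _, ⟨(he.one_le_layerFun hs₂).trans (layerFun_le he.injective hs₂), mul_coth_le hs₂⟩,
      cIWsq_eq hh₁ hh₂ hξ⟩
  · rcases eq_or_ne ξ 0 with rfl | hξ
    · exact ⟨1, by simp, 1, by simp, by rw [cKsq, if_pos rfl, cSWsq_eq hh₁ hh₂]⟩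
    have hs₁ : 0 < h₁ * ‖ξ‖ := mul_pos hh₁ (norm_pos_iff.2 hξ)
    have hs₂ : 0 < h₂ * ‖ξ‖ := mul_pos hh₂ (norm_pos_iff.2 hξ)
    exact ⟨_, ⟨he.one_le_layerFun hs₁, (layerFun_le he.injective hs₁).trans (mul_coth_le hs₁)⟩,
      _, ⟨hp.one_le_layerFun hs₂, (layerFun_le hp.injective hs₂).trans (mul_coth_le hs₂)⟩,
      cKsq_eq hp hρ₁ hρ₂ hh₁ hh₂ hξ⟩
  · rcases eq_or_ne ξ 0 with rfl | hξ
    · simp [cIWsq, cKsq]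
    have hs₁ : 0 < h₁ * ‖ξ‖ := mul_pos hh₁ (norm_pos_iff.2 hξ)
    have hs₂ : 0 < h₂ * ‖ξ‖ := mul_pos hh₂ (norm_pos_iff.2 hξ)
    have hk : (ρ₂ - ρ₁) * g ≠ 0 := (mul_pos (sub_pos.2 hρ) hg).ne'
    rw [cIWsq_eq hh₁ hh₂ hξ, cKsq_eq hp hρ₁ hρ₂ hh₁ hh₂ hξ, cSWsq_eq hh₁ hh₂,
      div_div_div_cancel_left' _ _ hk, div_div_div_cancel_left' _ _ hk, mul_one, mul_one]
    refine abs_weighted_sub_le ha₁ ha₂ (he.one_le_layerFun hs₁) (hp.one_le_layerFun hs₂)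
      (layerFun_le he.injective hs₁) (layerFun_le hp.injective hs₂)
      ((he.mul_coth_sub_layerFun_le hs₁).trans ?_) ((hp.mul_coth_sub_layerFun_le hs₂).trans ?_)
    · gcongr
      linarith
    · gcongr
      linarith
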